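/- Let $\mathcal M=(S,\mathrm{Act},P)$ be a Markov decision process: $S$ and $\mathrm{Act}\neq\emptyset$ are countable and $P\colon S\times \mathrm{Act}\times S\to[0,1]$ satisfies $\sum_{s'}P(s,a,s')\in\{0,1\}$; the action $a$ is enabled at $s$ if this sum is $1$. A scheduler $\sigma$ maps each history (finite sequence of states) to a probability distribution on the actions enabled at its last state, and induces a probability measure $\mathbb P^\sigma_{\mathcal M,s}$ on infinite paths from $s$ (a state without enabled actions is never left). It is positional if it depends only on the last state, and pure if all its distributions are Dirac. Write $\mathbb P^{\inf}_{\mathcal M,s}(\varphi)=\inf_\sigma\mathbb P^\sigma_{\mathcal M,s}(\varphi)$, $\mathbf F A$ for "$A$ is visited", $\mathbf F_{\le n}A$ for "$A$ is visited within $n$ steps", and $\mathbf G_{\le n}A$ for "the path stays in $A$ during the first $n$ steps" (with $A$ a state or a set of states). Let $s_0,g\in S$ be an initial and a target state, and let $\mathrm{Av}=\{s\in S:\mathbb P^{\inf}_{\mathcal M,s}(\mathbf F g)=0\}$. Let $\mathcal M^{\inf}$ be the MDP obtained from $\mathcal M$ by merging $\mathrm{Av}$ into a fresh sink $\bot$ (so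 $P^{\inf}(s,a,\bot)=\sum_{s'\in \mathrm{Av}}P(s,a,s')$ for $s\notin\mathrm{Av}$, and every action loops at $\bot$). Its initial state is $s_0$, or $\bot$ if $s_0\in\mathrm{Av}$. Let $S_0$ consist of this initial state, $g$ and $\bot$, and let $S_{n+1}$ be $S_n$ together with all states $s'$ such that $P^{\inf}(s,a,s')>0$ for some $s\in S_n$ and some action $a$. Let $\mathcal M^{\inf}_n$ be the MDP obtained from $\mathcal M^{\inf}$ by restricting it to $S_n$ and redirecting all transitions that leave $S_n$ to a fresh sink $s_\bot^n$. Put, for the initial state of $\mathcal M^{\inf}$ (denoted $s_0$ again), $$p_n^-=\mathbb P^{\inf}_{\mathcal M^{\inf},s_0}(\mathbf F_{\le n}\,g),\qquad p_n^+=\mathbb P^{\inf}_{\mathcal M^{\inf},s_0}\bigl(\mathbf F_{\le n}\,g\ \vee\ \mathbf G_{\le n}(\neg g\wedge\neg\bot)\bigr),$$ $$q_n^-=\mathbb P^{\inf}_{\mathcal M^{\inf}_n,s_0}(\mathbf F\,g),\qquad q_n^+=\mathbb P^{\inf}_{\mathcal M^{\inf}_n,s_0}\bigl(\mathbf F\,\{g,s_\bot^n\}\bigr).$$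 The scheme $\mathrm{ApproxScheme}_1^{\inf}$ (respectively $\mathrm{ApproxScheme}_2^{\inf}$) with precision $\varepsilon>0$ is the loop that, for $n=1,2,\dots$, computes $p_n^\pm$ (respectively $q_n^\pm$) and, at the first $n$ with $|p_n^+-p_n^-|\le\varepsilon$ (respectively $|q_n^+-q_n^-|\le\varepsilon$), stops and returns $p_n^-$ (respectively $q_n^-$). **Theorem.** Assume that every state of $\mathcal M$ has finitely many enabled actions, and that $\mathcal M$ is inf-decisive with respect to $g$ from $s_0$, that is, $\mathbb P^\sigma_{\mathcal M,s_0}(\mathbf F g\vee\mathbf F\,\mathrm{Av})=1$ for every pure positional scheduler $\sigma$. Then for every $\varepsilon>0$ both $\mathrm{ApproxScheme}_1^{\inf}$ and $\mathrm{ApproxScheme}_2^{\inf}$ terminate, and the value $v$ that each of them returns satisfies $|v-\mathbb P^{\inf}_{\mathcal M,s_0}(\mathbf F g)|\le\varepsilon$. -/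

import Mathlib

open scoped ENNReal
open ProbabilityTheory MeasureTheory

noncomputable section

/-- A Markov decision process with state set `S` and action set `Act`: each row `prob s a` of the
probabilistic transition function has total mass `1` (then `a` is enabled at `s`) or `0` (then `a`
is disabled at `s`). -/
structure MDP (S Act : Type*) where
  prob : S → Act → S → ℝ≥0∞
  sum_prob : ∀ s a, ∑' s', prob s a s' = 0 ∨ ∑' s', prob s a s' = 1

/-- The last state of a history `s_0 s_1 ⋯ s_n`, which has length `n`. -/
def lastState {S : Type*} {n : ℕ} (h : Finset.Iic n → S) : S :=
  h ⟨n, Finset.mem_Iic.2 le_rfl⟩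

namespace MDP

variable {S Act : Type*}

/-- The set of actions enabled at `s`. -/
def En (M : MDP S Act) (s : S) : Set Act := {a | ∑' s', M.prob s a s' = 1}

/-- Every state has finitely many enabled actions. -/
def FinitelyActionBranching (M : MDP S Act) : Prop := ∀ s, (M.En s).Finite

open Classical in
/-- The law of the next state when `a` is played at `s`. Schedulers play disabled actions only at
states without any enabled action; at such a state the process stays forever. -/
def next (M : MDP S Act) (s : S) (a : Act) : PMF S :=
  if h : ∑' s', M.prob s a s' = 1 then ⟨M.prob s a, h ▸ ENNReal.summable.hasSum⟩ else PMF.pure s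

/-- Schedulers: history-dependent and randomized. The constraint says that only enabled actions
are chosen; it is void at a state that has no enabled action (the choice is then irrelevant). -/
structure Scheduler (M : MDP S Act) where
  act : (n : ℕ) → (Finset.Iic n → S) → PMF Act
  support_subset : ∀ n (h : Finset.Iic n → S), (M.En (lastState h)).Nonempty →
    (act n h).support ⊆ M.En (lastState h)

namespace Scheduler

variable {M : MDP S Act}

/-- The choice depends only on the last state of the history. -/
def IsPositional (σ : M.Scheduler) : Prop :=
  ∀ (m n : ℕ) (h : Finset.Iic m → S) (h' : Finset.Iic n → S),
    lastState h = lastState h' → σ.act m h = σ.act n h'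

/-- Every choice is a Dirac distribution. -/
def IsPure (σ : M.Scheduler) : Prop :=
  ∀ (n : ℕ) (h : Finset.Iic n → S), ∃ a, σ.act n h = PMF.pure a

/-- The law of the state that follows the history `h`: draw an action `a` from `σ(h)`, then the
next state from `prob (last h) a`. -/
def step (σ : M.Scheduler) (n : ℕ) (h : Finset.Iic n → S) : PMF S :=
  (σ.act n h).bind (M.next (lastState h))

/-- `step` as a kernel, for the discrete σ-algebra on the states. -/
def stepKernel [Countable S] [MeasurableSpace S] [DiscreteMeasurableSpace S]
    (σ : M.Scheduler) (n : ℕ) : Kernel (Finset.Iic n → S) S where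
  toFun h := (σ.step n h).toMeasure
  measurable' := measurable_of_countable _

instance [Countable S] [MeasurableSpace S] [DiscreteMeasurableSpace S]
    (σ : M.Scheduler) (n : ℕ) : IsMarkovKernel (σ.stepKernel n) :=
  ⟨fun h => inferInstanceAs (IsProbabilityMeasure (σ.step n h).toMeasure)⟩

/-- The probability measure on infinite state sequences (with the σ-algebra generated by cylinders)
that `σ` induces from the initial state `s`. -/
def pathMeasure [Countable S] [MeasurableSpace S] [DiscreteMeasurableSpace S]
    (σ : M.Scheduler) (s : S) : Measure (ℕ → S) :=
  Kernel.traj (X := fun _ => S) σ.stepKernel 0 (fun _ => s)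

/-- The probability of the path event `E` under `σ` from `s`, the states carrying the discrete
σ-algebra. -/
def pr [Countable S] (σ : M.Scheduler) (s : S) (E : Set (ℕ → S)) : ℝ≥0∞ :=
  letI : MeasurableSpace S := ⊤
  haveI : DiscreteMeasurableSpace S := ⟨fun _ => trivial⟩
  σ.pathMeasure s E

end Scheduler

/-- The infimum over all schedulers of the probability of the path event `E` from `s`. -/
def infPr [Countable S] (M : MDP S Act) (s : S) (E : Set (ℕ → S)) : ℝ≥0∞ :=
  ⨅ σ : M.Scheduler, σ.pr s E

end MDP

/-- The paths that eventually visit `A`. -/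
def evt {S : Type*} (A : Set S) : Set (ℕ → S) := {ω | ∃ k, ω k ∈ A}

/-- The paths that visit `A` within `n` steps. -/
def evtLE {S : Type*} (n : ℕ) (A : Set S) : Set (ℕ → S) := {ω | ∃ k ≤ n, ω k ∈ A}

/-- The paths that stay in `A` for the first `n` steps. -/
def glbLE {S : Type*} (n : ℕ) (A : Set S) : Set (ℕ → S) := {ω | ∀ k ≤ n, ω k ∈ A}

namespace MDP

variable {S Act : Type*}

/-- The states from which the infimum probability of reaching `goal` is zero. -/
def avoidInf [Countable S] (M : MDP S Act) (goal : S) : Set S :=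
  {s | M.infPr s (evt {goal}) = 0}

/-- Under every pure positional scheduler, almost surely `goal` or its avoid set is reached. -/
def InfDecisive [Countable S] (M : MDP S Act) (goal s : S) : Prop :=
  ∀ σ : M.Scheduler, σ.IsPure → σ.IsPositional →
    σ.pr s (evt {goal} ∪ evt (M.avoidInf goal)) = 1

/-- The transition function of `M` restricted to the states in `K`, where every transition that
leaves `K` is redirected to a fresh state `none`, at which every action loops. -/
def redirectProb (M : MDP S Act) (K : Set S) : Option K → Act → Option K → ℝ≥0∞
  | some s, a, some s' => M.prob s a s'
  | some s, a, none => ∑' s' : (Kᶜ : Set S), M.prob s a s'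
  | none, _, none => 1
  | none, _, some _ => 0

/-- The MDP `M` restricted to `K`, with the complement of `K` merged into a fresh sink `none`. -/
def redirect (M : MDP S Act) (K : Set S) : MDP (Option K) Act where
  prob := M.redirectProb K
  sum_prob := by
    intro s a
    rw [← (Equiv.optionEquivSumPUnit.{0} K).symm.tsum_eq,
      Summable.tsum_sum ENNReal.summable ENNReal.summable]
    cases s with
    | none => right; simp [redirectProb]
    | some s =>
      have h : ∑' s' : K, M.prob s a s' + ∑' s' : (Kᶜ : Set S), M.prob s a s'
          = ∑' s', M.prob s a s' :=
        ENNReal.summable.tsum_add_tsum_compl ENNReal.summable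
      simpa [redirectProb, h] using M.sum_prob s a

open Classical in
/-- The state of `M.redirect K` that represents the state `s` of `M`. -/
def toRedirect (K : Set S) (s : S) : Option K :=
  if h : s ∈ K then some ⟨s, h⟩ else none

section collapse

variable [Countable S]

/-- States of the collapsed MDP: the states outside the avoid set, and the fresh state `none`. -/
abbrev CollapseState (M : MDP S Act) (goal : S) : Type _ :=
  Option ((M.avoidInf goal)ᶜ : Set S)

/-- The collapsed MDP: the avoid set is merged into the fresh sink `none`. -/
def collapse (M : MDP S Act) (goal : S) : MDP (M.CollapseState goal) Act :=
  M.redirect ((M.avoidInf goal)ᶜ)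

/-- The state of the collapsed MDP that represents `s`: itself if `s` is outside the avoid set
(such as `goal`, which reaches `goal` with probability one), and the sink otherwise. -/
def toCollapse (M : MDP S Act) (goal s : S) : M.CollapseState goal :=
  toRedirect ((M.avoidInf goal)ᶜ) s

/-- The states of the `n`-th slice except its sink: those found within `n` steps of the collapsed
MDP from the initial state, the target state and the sink of the collapsed MDP. -/
def sliceStates (M : MDP S Act) (s₀ goal : S) : ℕ → Set (M.CollapseState goal)
  | 0 => {M.toCollapse goal s₀, M.toCollapse goal goal, none}
  | n + 1 => M.sliceStates s₀ goal n ∪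
      {s' | ∃ s ∈ M.sliceStates s₀ goal n, ∃ a, 0 < (M.collapse goal).prob s a s'}

/-- States of the `n`-th sliced MDP; `none` is its fresh sink. -/
abbrev SliceState (M : MDP S Act) (s₀ goal : S) (n : ℕ) : Type _ :=
  Option (M.sliceStates s₀ goal n)

/-- The `n`-th sliced MDP: the transitions of the collapsed MDP that leave the states of the `n`-th
slice are redirected to a fresh sink. -/
def slice (M : MDP S Act) (s₀ goal : S) (n : ℕ) : MDP (M.SliceState s₀ goal n) Act :=
  (M.collapse goal).redirect (M.sliceStates s₀ goal n)

/-- The state of the `n`-th sliced MDP that represents the state `s` of `M`. -/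
def toSlice (M : MDP S Act) (s₀ goal : S) (n : ℕ) (s : S) : M.SliceState s₀ goal n :=
  toRedirect (M.sliceStates s₀ goal n) (M.toCollapse goal s)

/-- First scheme, lower bound: infimum probability, in the collapsed MDP, of reaching the target
within `n` steps. -/
def unfoldLo (M : MDP S Act) (s₀ goal : S) (n : ℕ) : ℝ :=
  ((M.collapse goal).infPr (M.toCollapse goal s₀) (evtLE n {M.toCollapse goal goal})).toReal

/-- First scheme, upper bound: infimum probability, in the collapsed MDP, of reaching the target
within `n` steps or visiting neither the target nor the sink within `n` steps. -/
def unfoldHi (M : MDP S Act) (s₀ goal : S) (n : ℕ) : ℝ :=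
  ((M.collapse goal).infPr (M.toCollapse goal s₀)
    (evtLE n {M.toCollapse goal goal} ∪ glbLE n ({M.toCollapse goal goal, none}ᶜ))).toReal

/-- Second scheme, lower bound: infimum probability, in the `n`-th sliced MDP, of reaching the
target. -/
def sliceLo (M : MDP S Act) (s₀ goal : S) (n : ℕ) : ℝ :=
  ((M.slice s₀ goal n).infPr (M.toSlice s₀ goal n s₀) (evt {M.toSlice s₀ goal n goal})).toReal

/-- Second scheme, upper bound: infimum probability, in the `n`-th sliced MDP, of reaching the
target or the fresh sink of that slice. -/
def sliceHi (M : MDP S Act) (s₀ goal : S) (n : ℕ) : ℝ :=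
  ((M.slice s₀ goal n).infPr (M.toSlice s₀ goal n s₀)
    (evt {M.toSlice s₀ goal n goal, none})).toReal

end collapse

end MDP

/-- Big-step semantics of the loop
`repeat n := n + 1; l := lo n; u := hi n until |u - l| ≤ ε; return l`:
`RepeatReturns lo hi ε n v` holds iff the loop, started with counter value `n`, terminates and
returns `v`. -/
inductive RepeatReturns (lo hi : ℕ → ℝ) (ε : ℝ) : ℕ → ℝ → Prop
  | exit (n : ℕ) (h : |hi (n + 1) - lo (n + 1)| ≤ ε) : RepeatReturns lo hi ε n (lo (n + 1))
  | next (n : ℕ) (v : ℝ) (h : ¬ |hi (n + 1) - lo (n + 1)| ≤ ε)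
      (hv : RepeatReturns lo hi ε (n + 1) v) : RepeatReturns lo hi ε n v

/-- The scheme based on unfoldings, run with precision `ε`, terminates and returns `v`. -/
def ApproxScheme1InfReturns {S Act : Type*} [Countable S] (M : MDP S Act) (s₀ goal : S)
    (ε v : ℝ) : Prop :=
  RepeatReturns (M.unfoldLo s₀ goal) (M.unfoldHi s₀ goal) ε 0 v

/-- The scheme based on sliced MDPs, run with precision `ε`, terminates and returns `v`. -/
def ApproxScheme2InfReturns {S Act : Type*} [Countable S] (M : MDP S Act) (s₀ goal : S)
    (ε v : ℝ) : Prop :=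
  RepeatReturns (M.sliceLo s₀ goal) (M.sliceHi s₀ goal) ε 0 v

end

/-!
Write `v s` for the infimum probability of reaching `goal` from `s`, and `L n s` for the result of
`n` rounds of value iteration. For every scheduler, however much history and randomness it uses,
`L n s` bounds the probability of reaching `goal` within `n` steps from below
(`MDP.Scheduler.le_pr_evtLE`). As every state has finitely many enabled actions, the minimum over
the actions commutes with the increasing limit of `L n`; an action function `α` that attains the
minimum therefore makes the limit superharmonic, and the pure positional scheduler that plays `α`
reaches `goal` with probability at most this limit (`MDP.exists_optimal_action`,
`MDP.pr_evt_le_reachLimit`). Hence `v = ⨆ n, L n`, and `α` attains the infimum.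

Decisiveness is applied to this one scheduler only: if `G n` denotes its probability of having
visited neither `goal` nor the avoid set after `n` steps, then `G n → 0` from the initial state.

For both schemes and every `n`, the values at the initial state satisfy
`L n ≤ lo n ≤ v ≤ hi n ≤ v + G n`, so `hi n - lo n → 0`, the loop terminates, and the returned lower
bound is `ε`-close to `v`. The bounds `lo n ≤ v` and `hi n ≤ v + G n` come from playing `α` in the
collapsed and in the sliced MDP; for `L n ≤ lo n` and `v ≤ hi n` every scheduler of these MDPs is
estimated. All four are proved without transporting schedulers or path measures between the MDPs:
the functions `L n`, `v` and `G n` vanish on the avoid set, so they are sub- or superharmonic in the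
collapsed MDP as well, and a path of length `n` from the initial state does not leave the `n`-th
slice.
-/

noncomputable section

/-! ### Expectations under discrete distributions -/

namespace PMF

variable {α β : Type*}

/-- The expectation of `f` under the discrete distribution `p`. -/
def mean (p : PMF α) (f : α → ℝ≥0∞) : ℝ≥0∞ := ∑' x, p x * f x

theorem mean_mono (p : PMF α) {f g : α → ℝ≥0∞} (h : ∀ x, f x ≤ g x) : p.mean f ≤ p.mean g :=
  ENNReal.tsum_le_tsum fun x => by gcongr; exact h x

theorem mean_const (p : PMF α) (c : ℝ≥0∞) : (p.mean fun _ => c) = c := by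
  rw [mean, ENNReal.tsum_mul_right, p.tsum_coe, one_mul]

theorem mean_le (p : PMF α) {f : α → ℝ≥0∞} {c : ℝ≥0∞} (h : ∀ x ∈ p.support, f x ≤ c) :
    p.mean f ≤ c := by
  rw [← p.mean_const c]
  refine ENNReal.tsum_le_tsum fun x => ?_
  by_cases hx : p x = 0
  · simp [hx]
  · gcongr
    exact h x ((p.mem_support_iff x).2 hx)

theorem le_mean (p : PMF α) {f : α → ℝ≥0∞} {c : ℝ≥0∞} (h : ∀ x ∈ p.support, c ≤ f x) :
    c ≤ p.mean f := by
  conv_lhs => rw [← p.mean_const c]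
  refine ENNReal.tsum_le_tsum fun x => ?_
  by_cases hx : p x = 0
  · simp [hx]
  · gcongr
    exact h x ((p.mem_support_iff x).2 hx)

theorem mean_pure (a : α) (f : α → ℝ≥0∞) : (PMF.pure a).mean f = f a := by
  classical
  rw [mean, tsum_eq_single a]
  · simp
  · intro b hb
    simp [PMF.pure_apply, hb]

theorem mean_bind (p : PMF α) (q : α → PMF β) (f : β → ℝ≥0∞) :
    (p.bind q).mean f = p.mean fun a => (q a).mean f := by
  simp only [mean, PMF.bind_apply, ← ENNReal.tsum_mul_right, ← ENNReal.tsum_mul_left]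
  rw [ENNReal.tsum_comm]
  simp only [mul_assoc]

theorem mean_map (p : PMF α) (q : α → β) (f : β → ℝ≥0∞) :
    (p.map q).mean f = p.mean fun a => f (q a) := by
  rw [← PMF.bind_pure_comp, mean_bind]
  simp only [Function.comp_apply, mean_pure]

theorem mean_add (p : PMF α) (f g : α → ℝ≥0∞) :
    (p.mean fun x => f x + g x) = p.mean f + p.mean g := by
  simp only [mean, mul_add]
  exact ENNReal.tsum_add

theorem mean_one_sub_le (p : PMF α) {f : α → ℝ≥0∞} (hf : ∀ x, f x ≤ 1) :
    (p.mean fun x => 1 - f x) ≤ 1 - p.mean f := by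
  have h1 : p.mean f ≤ 1 := p.mean_le fun x _ => hf x
  refine ENNReal.le_sub_of_add_le_right (ne_top_of_le_ne_top ENNReal.one_ne_top h1) ?_
  rw [← mean_add]
  exact p.mean_le fun x _ => (tsub_add_cancel_of_le (hf x)).le

theorem one_sub_mean_le (p : PMF α) (f : α → ℝ≥0∞) :
    1 - p.mean f ≤ p.mean fun x => 1 - f x := by
  rw [tsub_le_iff_right, ← mean_add]
  exact p.le_mean fun x _ => le_tsub_add

/-- Monotone convergence. -/
theorem mean_iSup (p : PMF α) {f : ℕ → α → ℝ≥0∞} (hf : Monotone f) :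
    (p.mean fun x => ⨆ n, f n x) = ⨆ n, p.mean (f n) := by
  simp only [mean, ENNReal.mul_iSup]
  let _ : MeasurableSpace α := ⊤
  simp only [← lintegral_count]
  exact lintegral_iSup (fun _ _ _ => trivial) fun m n h x => by dsimp only; gcongr; exact hf h x

theorem lintegral_toMeasure [Countable α] [MeasurableSpace α] [DiscreteMeasurableSpace α]
    (p : PMF α) (f : α → ℝ≥0∞) : ∫⁻ x, f x ∂p.toMeasure = p.mean f := by
  rw [lintegral_countable', mean]
  refine tsum_congr fun x => ?_
  rw [p.toMeasure_apply_singleton x (MeasurableSet.singleton x), mul_comm]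

end PMF

/-! ### Path measures -/

theorem measurableSet_glbLE {S : Type*} [MeasurableSpace S] [DiscreteMeasurableSpace S]
    (n : ℕ) (A : Set S) : MeasurableSet (glbLE n A) := by
  have : glbLE n A = ⋂ k, ⋂ (_ : k ≤ n), (fun ω : ℕ → S => ω k) ⁻¹' A := by
    ext; simp [glbLE]
  rw [this]
  exact MeasurableSet.iInter fun k => MeasurableSet.iInter fun _ =>
    measurable_pi_apply k (MeasurableSet.of_discrete)

namespace MDP.Scheduler

variable {S Act : Type*} {M : MDP S Act}

section pathMeasure

variable [Countable S] [MeasurableSpace S] [DiscreteMeasurableSpace S]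

instance (σ : M.Scheduler) (s : S) : IsProbabilityMeasure (σ.pathMeasure s) := by
  unfold pathMeasure
  infer_instance

theorem ae_pathMeasure_zero (σ : M.Scheduler) (s : S) : ∀ᵐ ω ∂σ.pathMeasure s, ω 0 = s := by
  have h := Kernel.traj_map_frestrictLe_apply (X := fun _ => S) (κ := σ.stepKernel) 0 0
    (fun _ => s)
  rw [Kernel.partialTraj_self, Kernel.id_apply] at h
  have h' : ∀ᵐ x ∂(σ.pathMeasure s).map (Preorder.frestrictLe 0), lastState x = s := by
    rw [pathMeasure, h, ae_dirac_eq]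
    rfl
  exact ae_of_ae_map (Preorder.measurable_frestrictLe 0).aemeasurable h'

/-- The Markov-type identity behind all computations: given the first `k` steps, the next state is
distributed according to `step`. -/
theorem lintegral_pathMeasure_succ (σ : M.Scheduler) (s : S) (k : ℕ)
    (F : (Finset.Iic k → S) → S → ℝ≥0∞) :
    ∫⁻ ω, F (Preorder.frestrictLe k ω) (ω (k + 1)) ∂σ.pathMeasure s
      = ∫⁻ ω, (σ.step k (Preorder.frestrictLe k ω)).mean (F (Preorder.frestrictLe k ω))
          ∂σ.pathMeasure s := by
  have h := Kernel.partialTraj_compProd_eq_map_traj (X := fun _ => S) (κ := σ.stepKernel)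
    (Nat.zero_le k) (x₀ := fun _ => s)
  have hF : Measurable (Function.uncurry F) := measurable_of_countable _
  have e1 : ∫⁻ ω, F (Preorder.frestrictLe k ω) (ω (k + 1)) ∂σ.pathMeasure s
      = ∫⁻ x, Function.uncurry F x ∂((σ.pathMeasure s).map
          fun ω => (Preorder.frestrictLe k ω, ω (k + 1))) := by
    rw [lintegral_map hF (by fun_prop)]
    rfl
  rw [e1, pathMeasure, ← h, Measure.lintegral_compProd hF,
    ← Kernel.traj_map_frestrictLe_apply, lintegral_map (measurable_of_countable _) (by fun_prop)]
  refine lintegral_congr fun ω => ?_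
  exact PMF.lintegral_toMeasure _ _

/-- Expected value of `φ` at time `k + 1` on the paths that have stayed in `A`: the requirement
`ω (k + 1) ∈ A` is absorbed into the integrand of the one-step expectation. -/
theorem lintegral_glbLE_succ (σ : M.Scheduler) (s : S) (k : ℕ) (A : Set S) (φ : S → ℝ≥0∞) :
    ∫⁻ ω in glbLE (k + 1) A, φ (ω (k + 1)) ∂σ.pathMeasure s
      = ∫⁻ ω in glbLE k A, (σ.step k (Preorder.frestrictLe k ω)).mean (A.indicator φ)
          ∂σ.pathMeasure s := by
  classical
  rw [← lintegral_indicator (measurableSet_glbLE _ _),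
    ← lintegral_indicator (measurableSet_glbLE _ _)]
  have h := σ.lintegral_pathMeasure_succ s k
    (fun h s' => if ∀ j, h j ∈ A then A.indicator φ s' else 0)
  convert h using 2 with ω
  · funext ω
    by_cases hk : ∀ j ≤ k, ω j ∈ A
    · by_cases hk' : ω (k + 1) ∈ A
      · have : ω ∈ glbLE (k + 1) A := fun j hj => by
          rcases Nat.le_succ_iff.1 hj with h | h
          · exact hk j h
          · exact h ▸ hk'
        simp +contextual [this, hk, hk']
      · have : ω ∉ glbLE (k + 1) A := fun h => hk' (h _ le_rfl)
        simp [this, hk']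
    · have : ω ∉ glbLE (k + 1) A := fun h => hk fun j hj => h j (hj.trans k.le_succ)
      have h2 : ¬ ∀ j : Finset.Iic k, Preorder.frestrictLe (π := fun _ => S) k ω j ∈ A :=
        fun h => hk fun j hj => h ⟨j, Finset.mem_Iic.2 hj⟩
      rw [Set.indicator_of_notMem this, if_neg h2]
  · funext ω
    by_cases hk : ∀ j ≤ k, ω j ∈ A
    · have : ω ∈ glbLE k A := hk
      have h2 : ∀ j : Finset.Iic k, Preorder.frestrictLe (π := fun _ => S) k ω j ∈ A :=
        fun j => hk j (Finset.mem_Iic.1 j.2)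
      simp only [Set.indicator_of_mem this, if_pos h2]
    · have : ω ∉ glbLE k A := hk
      have h2 : ¬ ∀ j : Finset.Iic k, Preorder.frestrictLe (π := fun _ => S) k ω j ∈ A :=
        fun h => hk fun j hj => h ⟨j, Finset.mem_Iic.2 hj⟩
      simp only [Set.indicator_of_notMem this, if_neg h2, PMF.mean_const]

end pathMeasure

/-- `σ` plays the action `a` with positive probability after some history that ends in `s`. -/
def Plays (σ : M.Scheduler) (s : S) (a : Act) : Prop :=
  ∃ (k : ℕ) (h : Finset.Iic k → S), lastState h = s ∧ a ∈ (σ.act k h).support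

theorem mean_step (σ : M.Scheduler) (k : ℕ) (h : Finset.Iic k → S) (f : S → ℝ≥0∞) :
    (σ.step k h).mean f = (σ.act k h).mean fun a => (M.next (lastState h) a).mean f :=
  PMF.mean_bind _ _ _

variable [Countable S]

theorem pr_mono (σ : M.Scheduler) (s : S) {E F : Set (ℕ → S)} (h : E ⊆ F) :
    σ.pr s E ≤ σ.pr s F := measure_mono h

theorem pr_union_le (σ : M.Scheduler) (s : S) (E F : Set (ℕ → S)) :
    σ.pr s (E ∪ F) ≤ σ.pr s E + σ.pr s F := measure_union_le _ _

theorem pr_le_one (σ : M.Scheduler) (s : S) (E : Set (ℕ → S)) : σ.pr s E ≤ 1 := by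
  let _ : MeasurableSpace S := ⊤
  have _ : DiscreteMeasurableSpace S := ⟨fun _ => trivial⟩
  exact prob_le_one

/-- A sequence of functions that is superharmonic on `A` for all actions that `σ` plays bounds the
probability of staying in `A` from above. -/
theorem pr_glbLE_le (σ : M.Scheduler) {A : Set S} {g : ℕ → S → ℝ≥0∞}
    (h0 : ∀ s ∈ A, 1 ≤ g 0 s)
    (h : ∀ n, ∀ s ∈ A, ∀ a, σ.Plays s a → (M.next s a).mean (A.indicator (g n)) ≤ g (n + 1) s)
    (n : ℕ) (s : S) : σ.pr s (glbLE n A) ≤ g n s := by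
  let _ : MeasurableSpace S := ⊤
  have _ : DiscreteMeasurableSpace S := ⟨fun _ => trivial⟩
  -- With `m + k` fixed, the left-hand side can only decrease as `k` grows.
  have key : ∀ k m, ∫⁻ ω in glbLE k A, g m (ω k) ∂σ.pathMeasure s ≤ g (m + k) s := by
    intro k
    induction k with
    | zero =>
      intro m
      calc ∫⁻ ω in glbLE 0 A, g m (ω 0) ∂σ.pathMeasure s
          ≤ ∫⁻ ω, g m (ω 0) ∂σ.pathMeasure s := setLIntegral_le_lintegral _ _
        _ = ∫⁻ _, g m s ∂σ.pathMeasure s :=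
          lintegral_congr_ae ((σ.ae_pathMeasure_zero s).mono fun ω hω => by simp only [hω])
        _ = g (m + 0) s := by simp
    | succ k ih =>
      intro m
      rw [lintegral_glbLE_succ]
      refine le_trans (setLIntegral_mono' (measurableSet_glbLE _ _) fun ω hω => ?_)
        ((ih (m + 1)).trans_eq (by congr 1; ring))
      rw [mean_step]
      exact PMF.mean_le _ fun a ha => h m _ (hω k le_rfl) a ⟨k, _, rfl, ha⟩
  calc σ.pr s (glbLE n A) = ∫⁻ _ in glbLE n A, 1 ∂σ.pathMeasure s := by
        rw [setLIntegral_one]; rfl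
    _ ≤ ∫⁻ ω in glbLE n A, g 0 (ω n) ∂σ.pathMeasure s :=
        setLIntegral_mono' (measurableSet_glbLE _ _) fun ω hω => h0 _ (hω n le_rfl)
    _ ≤ g n s := by simpa using key n 0

/-- A sequence of functions that vanishes off `A` and is subharmonic on `A` for all actions that
`σ` plays bounds the probability of staying in `A` from below. -/
theorem le_pr_glbLE (σ : M.Scheduler) {A : Set S} {g : ℕ → S → ℝ≥0∞}
    (hA : ∀ n, ∀ s ∉ A, g n s = 0) (h0 : ∀ s, g 0 s ≤ 1)
    (h : ∀ n, ∀ s ∈ A, ∀ a, σ.Plays s a → g (n + 1) s ≤ (M.next s a).mean (g n))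
    (n : ℕ) (s : S) : g n s ≤ σ.pr s (glbLE n A) := by
  let _ : MeasurableSpace S := ⊤
  have _ : DiscreteMeasurableSpace S := ⟨fun _ => trivial⟩
  have hind : ∀ m, A.indicator (g m) = g m := fun m =>
    Set.indicator_eq_self.2 fun s hs => by_contra fun hs' => hs (hA m s hs')
  -- With `m + k` fixed, the right-hand side can only increase as `k` grows.
  have key : ∀ k m, g (m + k) s ≤ ∫⁻ ω in glbLE k A, g m (ω k) ∂σ.pathMeasure s := by
    intro k
    induction k with
    | zero =>
      intro m
      calc g (m + 0) s = ∫⁻ _, g m s ∂σ.pathMeasure s := by simp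
        _ = ∫⁻ ω, g m (ω 0) ∂σ.pathMeasure s :=
          lintegral_congr_ae ((σ.ae_pathMeasure_zero s).mono fun ω hω => by simp only [hω])
        _ = ∫⁻ ω in glbLE 0 A, g m (ω 0) ∂σ.pathMeasure s := by
          refine (setLIntegral_eq_of_support_subset fun ω hω => ?_).symm
          intro j hj
          rw [Nat.le_zero.1 hj]
          exact by_contra fun h' => hω (hA m _ h')
        _ ≤ _ := le_rfl
    | succ k ih =>
      intro m
      rw [lintegral_glbLE_succ, hind]
      refine ((ih (m + 1)).trans_eq' (by congr 1; ring)).trans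
        (setLIntegral_mono' (measurableSet_glbLE _ _) fun ω hω => ?_)
      rw [mean_step]
      exact PMF.le_mean _ fun a ha => h m _ (hω k le_rfl) a ⟨k, _, rfl, ha⟩
  calc g n s ≤ ∫⁻ ω in glbLE n A, g 0 (ω n) ∂σ.pathMeasure s := by simpa using key n 0
    _ ≤ ∫⁻ _ in glbLE n A, 1 ∂σ.pathMeasure s :=
        setLIntegral_mono' (measurableSet_glbLE _ _) fun ω _ => h0 _
    _ = σ.pr s (glbLE n A) := by rw [setLIntegral_one]; rfl

theorem pr_evtLE (σ : M.Scheduler) (s : S) (n : ℕ) (T : Set S) :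
    σ.pr s (evtLE n T) = 1 - σ.pr s (glbLE n Tᶜ) := by
  let _ : MeasurableSpace S := ⊤
  have _ : DiscreteMeasurableSpace S := ⟨fun _ => trivial⟩
  have : evtLE n T = (glbLE n Tᶜ)ᶜ := by ext; simp [evtLE, glbLE]
  rw [this]
  exact prob_compl_eq_one_sub (measurableSet_glbLE n _)

theorem pr_glbLE_compl (σ : M.Scheduler) (s : S) (n : ℕ) (T : Set S) :
    σ.pr s (glbLE n Tᶜ) = 1 - σ.pr s (evtLE n T) := by
  rw [pr_evtLE, ENNReal.sub_sub_cancel ENNReal.one_ne_top (pr_le_one _ _ _)]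

/-- Functions vanishing off `T` at time `0` and subharmonic off `T` for the actions that `σ` plays
bound the probability of reaching `T` from below: `1 - f` bounds the probability of avoiding
`T`. -/
theorem le_pr_evtLE (σ : M.Scheduler) {T : Set S} {f : ℕ → S → ℝ≥0∞}
    (hf : ∀ n s, f n s ≤ 1) (h0 : ∀ s ∉ T, f 0 s = 0)
    (h : ∀ n, ∀ s ∉ T, ∀ a, σ.Plays s a → f (n + 1) s ≤ (M.next s a).mean (f n))
    (n : ℕ) (s : S) : f n s ≤ σ.pr s (evtLE n T) := by
  rw [pr_evtLE]
  have := σ.pr_glbLE_le (A := Tᶜ) (g := fun n s => 1 - f n s) (fun s hs => by simp [h0 s hs])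
    (fun n s hs a ha => by
      refine (PMF.mean_mono _ fun x => Set.indicator_le_self' (fun _ _ => zero_le) x).trans ?_
      refine (PMF.mean_one_sub_le _ (hf n)).trans ?_
      exact tsub_le_tsub_left (h n s hs a ha) 1) n s
  refine (tsub_le_tsub_left this 1).trans' ?_
  rw [ENNReal.sub_sub_cancel ENNReal.one_ne_top (hf n s)]

/-- A function that is at least `1` on `T` and superharmonic off `T` for the actions that `σ` plays
bounds the probability of reaching `T` from above. -/
theorem pr_evtLE_le (σ : M.Scheduler) {T : Set S} {w : S → ℝ≥0∞} (h0 : ∀ s ∈ T, 1 ≤ w s)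
    (h : ∀ s ∉ T, ∀ a, σ.Plays s a → (M.next s a).mean w ≤ w s) (n : ℕ) (s : S) :
    σ.pr s (evtLE n T) ≤ w s := by
  rw [pr_evtLE, tsub_le_iff_left, ← tsub_le_iff_right]
  exact σ.le_pr_glbLE (A := Tᶜ) (g := fun _ s => 1 - w s)
    (fun _ s hs => tsub_eq_zero_of_le (h0 s (not_not.1 hs)))
    (fun s => tsub_le_self)
    (fun _ s hs a ha => (tsub_le_tsub_left (h s hs a ha) 1).trans (PMF.one_sub_mean_le _ _)) n s

theorem iSup_pr_evtLE (σ : M.Scheduler) (s : S) (T : Set S) :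
    ⨆ n, σ.pr s (evtLE n T) = σ.pr s (evt T) := by
  have h : evt T = ⋃ n, evtLE n T := by
    ext ω
    simp only [evt, evtLE, Set.mem_ofPred_eq, Set.mem_iUnion]
    exact ⟨fun ⟨k, hk⟩ => ⟨k, k, le_rfl, hk⟩, fun ⟨_, k, _, hk⟩ => ⟨k, hk⟩⟩
  rw [h]
  refine (Monotone.measure_iUnion ?_).symm
  exact fun m n hmn ω ⟨k, hk, hω⟩ => ⟨k, hk.trans hmn, hω⟩

/-- If `T` is visited almost surely, then the probability of not having visited it yet vanishes. -/
theorem tendsto_pr_glbLE_compl (σ : M.Scheduler) {s : S} {T : Set S} (h : σ.pr s (evt T) = 1) :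
    Filter.Tendsto (fun n => σ.pr s (glbLE n Tᶜ)) Filter.atTop (nhds 0) := by
  have hm : Monotone fun n => σ.pr s (evtLE n T) := fun m n hmn =>
    σ.pr_mono s fun ω ⟨k, hk, hω⟩ => ⟨k, hk.trans hmn, hω⟩
  have ht := tendsto_atTop_iSup hm
  rw [iSup_pr_evtLE, h] at ht
  simp only [pr_glbLE_compl]
  simpa using ENNReal.Tendsto.sub (tendsto_const_nhds (x := (1 : ℝ≥0∞))) ht
    (Or.inl ENNReal.one_ne_top)

/-- Almost surely, a state at which every action loops is never left. -/
theorem pr_leave_sink (σ : M.Scheduler) (s : S) {b : S} (hb : ∀ a, M.next b a = PMF.pure b) :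
    σ.pr s {ω | ∃ k m, k ≤ m ∧ ω k = b ∧ ω m ≠ b} = 0 := by
  classical
  let _ : MeasurableSpace S := ⊤
  have _ : DiscreteMeasurableSpace S := ⟨fun _ => trivial⟩
  have h1 : ∀ k, ∀ᵐ ω ∂σ.pathMeasure s, ω k = b → ω (k + 1) = b := by
    intro k
    have h := σ.lintegral_pathMeasure_succ s k
      (fun h s' => if lastState h = b ∧ s' ≠ b then 1 else 0)
    have hz : ∀ ω : ℕ → S, (σ.step k (Preorder.frestrictLe k ω)).mean
        (fun s' => if lastState (Preorder.frestrictLe (π := fun _ => S) k ω) = b ∧ s' ≠ b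
          then 1 else 0) = 0 := by
      intro ω
      rw [mean_step]
      refine nonpos_iff_eq_zero.1 (PMF.mean_le _ fun a _ => ?_)
      by_cases hl : lastState (Preorder.frestrictLe (π := fun _ => S) k ω) = b
      · rw [hl, hb, PMF.mean_pure]
        simp
      · simp [hl, PMF.mean_const]
    simp only [hz, lintegral_zero] at h
    rw [lintegral_eq_zero_iff] at h
    · filter_upwards [h] with ω hω hk
      by_contra hk'
      have : lastState (Preorder.frestrictLe (π := fun _ => S) k ω) = b := hk
      simp [this, hk'] at hω
    · have : Measurable (Function.uncurry fun (h : Finset.Iic k → S) (s' : S) =>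
          if lastState h = b ∧ s' ≠ b then (1 : ℝ≥0∞) else 0) := measurable_of_countable _
      exact this.comp (g := Function.uncurry _)
        (f := fun ω : ℕ → S => (Preorder.frestrictLe k ω, ω (k + 1))) (by fun_prop)
  have h2 : ∀ᵐ ω ∂σ.pathMeasure s, ¬ ∃ k m, k ≤ m ∧ ω k = b ∧ ω m ≠ b := by
    filter_upwards [ae_all_iff.2 h1] with ω hω
    rintro ⟨k, m, hkm, hk, hm⟩
    induction m, hkm using Nat.le_induction with
    | base => exact hm hk
    | succ m _ ih => exact ih fun h => hm (hω m h)
  have h3 := ae_iff.1 h2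
  simp only [not_not] at h3
  exact h3

end MDP.Scheduler

namespace MDP

variable {S Act : Type*}

/-! ### Pure positional schedulers -/

/-- The actions that a scheduler may choose at `s`: the enabled ones, or all of them if none is
enabled. -/
def allowed (M : MDP S Act) (s : S) : Set Act := {a | (M.En s).Nonempty → a ∈ M.En s}

theorem allowed_nonempty [Nonempty Act] (M : MDP S Act) (s : S) : (M.allowed s).Nonempty := by
  by_cases h : (M.En s).Nonempty
  · exact ⟨h.some, fun _ => h.some_mem⟩
  · exact ⟨Classical.arbitrary Act, fun h' => absurd h' h⟩

theorem Scheduler.Plays.allowed {M : MDP S Act} {σ : M.Scheduler} {s : S} {a : Act}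
    (h : σ.Plays s a) : a ∈ M.allowed s := by
  obtain ⟨k, h, rfl, ha⟩ := h
  exact fun hE => σ.support_subset k h hE ha

/-- The pure positional scheduler that plays `α s` at `s`. -/
def ofAction (M : MDP S Act) (α : S → Act) (hα : ∀ s, α s ∈ M.allowed s) : M.Scheduler where
  act _ h := PMF.pure (α (lastState h))
  support_subset _ h hE := by
    rw [PMF.support_pure, Set.singleton_subset_iff]
    exact hα _ hE

theorem isPure_ofAction (M : MDP S Act) (α : S → Act) (hα : ∀ s, α s ∈ M.allowed s) :
    (M.ofAction α hα).IsPure := fun _ h => ⟨α (lastState h), rfl⟩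

theorem isPositional_ofAction (M : MDP S Act) (α : S → Act) (hα : ∀ s, α s ∈ M.allowed s) :
    (M.ofAction α hα).IsPositional := fun _ _ h h' e => by
  change PMF.pure (α (lastState h)) = PMF.pure (α (lastState h'))
  rw [e]

theorem eq_of_plays_ofAction {M : MDP S Act} {α : S → Act} {hα : ∀ s, α s ∈ M.allowed s} {s : S}
    {a : Act} (h : (M.ofAction α hα).Plays s a) : a = α s := by
  obtain ⟨k, h, rfl, ha⟩ := h
  simpa [ofAction, PMF.support_pure] using ha

theorem next_apply_of_mem (M : MDP S Act) {s : S} {a : Act} (h : a ∈ M.En s) (s' : S) :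
    M.next s a s' = M.prob s a s' := by
  have h' : ∑' s', M.prob s a s' = 1 := h
  exact congrArg (fun p : PMF S => p s') (dif_pos h')

theorem next_of_notMem (M : MDP S Act) {s : S} {a : Act} (h : a ∉ M.En s) :
    M.next s a = PMF.pure s := dif_neg h

/-! ### Value iteration -/

section value

open Classical in
/-- Value iteration for the infimum probability of reaching `goal` within `n` steps. -/
def reachValue (M : MDP S Act) (goal : S) : ℕ → S → ℝ≥0∞
  | 0, s => if s = goal then 1 else 0
  | n + 1, s => if s = goal then 1 else ⨅ a ∈ M.allowed s, (M.next s a).mean (M.reachValue goal n)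

/-- The limit of value iteration. -/
def reachLimit (M : MDP S Act) (goal s : S) : ℝ≥0∞ := ⨆ n, M.reachValue goal n s

variable (M : MDP S Act) (goal : S)

theorem reachValue_goal (n : ℕ) : M.reachValue goal n goal = 1 := by
  cases n <;> simp [reachValue]

theorem reachValue_zero {s : S} (hs : s ≠ goal) : M.reachValue goal 0 s = 0 := by
  simp [reachValue, hs]

theorem reachValue_succ_le (n : ℕ) {s : S} (hs : s ≠ goal) {a : Act} (ha : a ∈ M.allowed s) :
    M.reachValue goal (n + 1) s ≤ (M.next s a).mean (M.reachValue goal n) := by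
  simp only [reachValue, if_neg hs]
  exact iInf₂_le a ha

theorem reachValue_le_one [Nonempty Act] (n : ℕ) (s : S) : M.reachValue goal n s ≤ 1 := by
  induction n generalizing s with
  | zero => rw [reachValue]; split_ifs <;> simp
  | succ n ih =>
    by_cases hs : s = goal
    · rw [hs, reachValue_goal]
    · obtain ⟨a, ha⟩ := M.allowed_nonempty s
      exact (M.reachValue_succ_le goal n hs ha).trans (PMF.mean_le _ fun x _ => ih x)

theorem monotone_reachValue : Monotone (M.reachValue goal) := by
  refine monotone_nat_of_le_succ fun n => ?_
  induction n with
  | zero =>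
    intro s
    by_cases hs : s = goal
    · rw [hs, reachValue_goal, reachValue_goal]
    · simp [reachValue_zero M goal hs]
  | succ n ih =>
    intro s
    by_cases hs : s = goal
    · rw [hs, reachValue_goal, reachValue_goal]
    · simp only [reachValue, if_neg hs] at ih ⊢
      exact iInf₂_mono fun a _ => PMF.mean_mono _ ih

theorem reachValue_le_reachLimit (n : ℕ) (s : S) : M.reachValue goal n s ≤ M.reachLimit goal s :=
  le_iSup (fun n => M.reachValue goal n s) n

theorem reachLimit_goal : M.reachLimit goal goal = 1 := by
  simp [reachLimit, reachValue_goal]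

theorem reachLimit_le_one [Nonempty Act] (s : S) : M.reachLimit goal s ≤ 1 :=
  iSup_le fun n => M.reachValue_le_one goal n s

theorem mean_reachLimit (p : PMF S) :
    p.mean (M.reachLimit goal) = ⨆ n, p.mean (M.reachValue goal n) :=
  p.mean_iSup (M.monotone_reachValue goal)

variable {M}

/-- With finitely many enabled actions, some action attains the limit of value iteration: the
minimum over a finite set commutes with the increasing limit. -/
theorem exists_mean_reachLimit_le [Nonempty Act] (hfin : M.FinitelyActionBranching) (s : S) :
    ∃ a ∈ M.allowed s, s ≠ goal →
      (M.next s a).mean (M.reachLimit goal) ≤ M.reachLimit goal s := by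
  by_cases hE : (M.En s).Nonempty
  · by_contra! hcon
    have hs : s ≠ goal := (hcon hE.some fun _ => hE.some_mem).1
    have h1 : ∀ a ∈ M.En s, ∃ n, M.reachLimit goal s < (M.next s a).mean (M.reachValue goal n) := by
      intro a ha
      have := (hcon a fun _ => ha).2
      rwa [mean_reachLimit, lt_iSup_iff] at this
    choose! N hN using h1
    obtain ⟨m, hm⟩ := ((hfin s).image N).bddAbove
    have h2 : ∀ a ∈ M.En s, M.reachLimit goal s < (M.next s a).mean (M.reachValue goal m) :=
      fun a ha => (hN a ha).trans_le (PMF.mean_mono _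
        (M.monotone_reachValue goal (hm (Set.mem_image_of_mem N ha))))
    have hall : M.allowed s = M.En s := Set.ext fun a => ⟨fun h => h hE, fun h _ => h⟩
    obtain ⟨a, ha, hmin⟩ := Set.exists_min_image (M.En s)
      (fun a => (M.next s a).mean (M.reachValue goal m)) (hfin s) hE
    refine (M.reachValue_le_reachLimit goal (m + 1) s).not_gt ((h2 a ha).trans_le ?_)
    simp only [reachValue, if_neg hs, hall]
    exact le_iInf₂ hmin
  · refine ⟨Classical.arbitrary Act, fun h => absurd h hE, fun _ => ?_⟩
    rw [M.next_of_notMem fun h => hE ⟨_, h⟩, PMF.mean_pure]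

/-- Value iteration is a lower bound for every scheduler; no finiteness of the action sets is
needed here. -/
theorem reachLimit_le_infPr [Countable S] [Nonempty Act] (s : S) :
    M.reachLimit goal s ≤ M.infPr s (evt {goal}) := by
  refine le_iInf fun σ => ?_
  rw [← σ.iSup_pr_evtLE]
  exact iSup_mono fun n => σ.le_pr_evtLE (T := {goal}) (M.reachValue_le_one goal)
    (fun s hs => M.reachValue_zero goal hs)
    (fun n s hs a ha => M.reachValue_succ_le goal n hs ha.allowed) n s

/-- A scheduler that only plays actions attaining the limit of value iteration does not exceed that
limit. -/
theorem pr_evt_le_reachLimit [Countable S] (σ : M.Scheduler)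
    (hσ : ∀ s ≠ goal, ∀ a, σ.Plays s a →
      (M.next s a).mean (M.reachLimit goal) ≤ M.reachLimit goal s) (s : S) :
    σ.pr s (evt {goal}) ≤ M.reachLimit goal s := by
  rw [← σ.iSup_pr_evtLE]
  refine iSup_le fun n => σ.pr_evtLE_le (T := {goal}) ?_ hσ n s
  rintro s rfl
  exact (M.reachLimit_goal s).ge

/-- An action function that attains the limit of value iteration. -/
theorem exists_optimal_action [Nonempty Act] (hfin : M.FinitelyActionBranching) :
    ∃ α : S → Act, (∀ s, α s ∈ M.allowed s) ∧ ∀ s ≠ goal,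
      (M.next s (α s)).mean (M.reachLimit goal) ≤ M.reachLimit goal s := by
  choose α hα using M.exists_mean_reachLimit_le goal hfin
  exact ⟨α, fun s => (hα s).1, fun s => (hα s).2⟩

theorem infPr_evt [Countable S] [Nonempty Act] (hfin : M.FinitelyActionBranching) (s : S) :
    M.infPr s (evt {goal}) = M.reachLimit goal s := by
  refine le_antisymm ?_ (reachLimit_le_infPr goal s)
  obtain ⟨α, hα, hopt⟩ := exists_optimal_action goal hfin
  refine (iInf_le _ (M.ofAction α hα)).trans (pr_evt_le_reachLimit goal _ ?_ s)
  intro s hs a ha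
  rw [eq_of_plays_ofAction ha]
  exact hopt s hs

end value

/-! ### Merging the complement of a set of states into a sink -/

section redirect

variable (M : MDP S Act) (K : Set S)

theorem toRedirect_of_mem {s : S} (h : s ∈ K) : toRedirect K s = some ⟨s, h⟩ := dif_pos h

theorem toRedirect_of_notMem {s : S} (h : s ∉ K) : toRedirect K s = none := dif_neg h

/-- The function on `Option K` that equals `f` on `K` and `c` at the sink. -/
def redirectFun {β : Type*} (c : β) (f : S → β) : Option K → β :=
  fun x => x.elim c fun s => f s

theorem En_redirect_some (s : K) : (M.redirect K).En (some s) = M.En s := by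
  ext a
  have h : ∑' s' : K, M.prob s a s' + ∑' s' : (Kᶜ : Set S), M.prob s a s'
      = ∑' s', M.prob s a s' := ENNReal.summable.tsum_add_tsum_compl ENNReal.summable
  have h2 : ∑' s', (M.redirect K).prob (some s) a s' = ∑' s', M.prob s a s' := by
    rw [← (Equiv.optionEquivSumPUnit.{0} K).symm.tsum_eq,
      Summable.tsum_sum ENNReal.summable ENNReal.summable]
    simpa [redirect, redirectProb] using h
  simp only [En, Set.mem_ofPred_eq, h2]

theorem next_redirect_none (a : Act) : (M.redirect K).next none a = PMF.pure none := by
  by_cases h : a ∈ (M.redirect K).En none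
  · ext x
    rw [next_apply_of_mem _ h]
    cases x <;> simp [redirect, redirectProb]
  · exact next_of_notMem _ h

/-- A step of the redirected MDP is a step of `M` followed by the quotient map. This includes the
case of a disabled action, where both processes stay. -/
theorem next_redirect_some (s : K) (a : Act) :
    (M.redirect K).next (some s) a = (M.next s a).map (toRedirect K) := by
  classical
  by_cases h : a ∈ M.En s
  · have h' : a ∈ (M.redirect K).En (some s) := by rwa [En_redirect_some]
    ext x
    rw [next_apply_of_mem _ h', PMF.map_apply]
    simp only [next_apply_of_mem _ h]
    cases x with
    | none =>
      change ∑' s' : (Kᶜ : Set S), M.prob s a s' = _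
      rw [tsum_subtype]
      refine tsum_congr fun t => ?_
      by_cases ht : t ∈ K
      · simp [toRedirect_of_mem K ht, ht]
      · simp [toRedirect_of_notMem K ht, ht]
    | some x =>
      change M.prob s a x = _
      rw [tsum_eq_single x.1]
      · rw [toRedirect_of_mem K x.2]
        simp
      · intro t htx
        by_cases ht : t ∈ K
        · rw [toRedirect_of_mem K ht, if_neg]
          rintro h
          exact htx (congrArg Subtype.val (Option.some.inj h)).symm
        · simp [toRedirect_of_notMem K ht]
  · have h' : a ∉ (M.redirect K).En (some s) := by rwa [En_redirect_some]
    rw [next_of_notMem _ h, next_of_notMem _ h', PMF.pure_map, toRedirect_of_mem K s.2]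

theorem mean_next_redirect_some (s : K) (a : Act) (f : Option K → ℝ≥0∞) :
    ((M.redirect K).next (some s) a).mean f = (M.next s a).mean fun t => f (toRedirect K t) := by
  rw [next_redirect_some, PMF.mean_map]

theorem mean_next_redirect_none (a : Act) (f : Option K → ℝ≥0∞) :
    ((M.redirect K).next none a).mean f = f none := by
  rw [next_redirect_none, PMF.mean_pure]

theorem mem_allowed_redirect_some {s : K} {a : Act} :
    a ∈ (M.redirect K).allowed (some s) ↔ a ∈ M.allowed s := by
  simp only [allowed, Set.mem_ofPred_eq, En_redirect_some]

theorem redirectFun_mem_allowed {α : S → Act} (hα : ∀ s, α s ∈ M.allowed s) (c : Act)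
    (x : Option K) : redirectFun K c α x ∈ (M.redirect K).allowed x := by
  cases x with
  | none =>
    refine fun _ => ?_
    change _ = _
    rw [tsum_eq_single none]
    · rfl
    · rintro (_ | b) hb
      · exact absurd rfl hb
      · rfl
  | some x => exact (M.mem_allowed_redirect_some K).2 (hα x)

theorem redirectFun_toRedirect_of_mem {β : Type*} (c : β) (f : S → β) {s : S} (h : s ∈ K) :
    redirectFun K c f (toRedirect K s) = f s := by
  rw [toRedirect_of_mem K h]
  rfl

theorem redirectFun_toRedirect {β : Type*} {c : β} {f : S → β} (h : ∀ s ∉ K, f s = c) (s : S) :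
    redirectFun K c f (toRedirect K s) = f s := by
  by_cases hs : s ∈ K
  · exact redirectFun_toRedirect_of_mem K c f hs
  · rw [toRedirect_of_notMem K hs, h s hs]
    rfl

end redirect

end MDP

namespace MDP

/-! ### Staying in a set under an action function -/

section stay

variable {S Act : Type*} (M : MDP S Act) (α : S → Act) (A : Set S)

/-- The probability of staying in `A` for `n` steps when `α` selects the actions, as computed by
backward recursion. -/
def stayValue : ℕ → S → ℝ≥0∞
  | 0 => A.indicator 1
  | n + 1 => A.indicator fun s => (M.next s (α s)).mean (stayValue n)

theorem stayValue_of_notMem (n : ℕ) {s : S} (hs : s ∉ A) : M.stayValue α A n s = 0 := by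
  cases n <;> simp [stayValue, hs]

theorem stayValue_zero {s : S} (hs : s ∈ A) : M.stayValue α A 0 s = 1 := by
  simp [stayValue, hs]

theorem stayValue_succ (n : ℕ) {s : S} (hs : s ∈ A) :
    M.stayValue α A (n + 1) s = (M.next s (α s)).mean (M.stayValue α A n) := by
  simp [stayValue, hs]

theorem stayValue_le_one (n : ℕ) (s : S) : M.stayValue α A n s ≤ 1 := by
  by_cases hs : s ∈ A
  · induction n generalizing s with
    | zero => rw [stayValue_zero M α A hs]
    | succ n ih =>
      rw [stayValue_succ M α A n hs]
      refine PMF.mean_le _ fun x _ => ?_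
      by_cases hx : x ∈ A
      · exact ih x hx
      · simp [stayValue_of_notMem M α A n hx]
  · simp [stayValue_of_notMem M α A n hs]

theorem stayValue_le_pr [Countable S] (hα : ∀ s, α s ∈ M.allowed s) (n : ℕ) (s : S) :
    M.stayValue α A n s ≤ (M.ofAction α hα).pr s (glbLE n A) := by
  refine Scheduler.le_pr_glbLE _ (fun n s hs => M.stayValue_of_notMem α A n hs)
    (M.stayValue_le_one α A 0) (fun n s hs a ha => ?_) n s
  rw [eq_of_plays_ofAction ha, stayValue_succ M α A n hs]

end stay

variable {S Act : Type*} [Countable S] {M : MDP S Act} {s₀ goal : S}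

/-! ### The collapsed MDP -/

section collapse

variable (M goal) in
/-- The states outside the avoid set and different from `goal`. -/
def undecided : Set S := ({goal} ∪ M.avoidInf goal)ᶜ

variable (M goal) in
/-- A function on the states of `M`, transferred to the collapsed MDP with value `0` at the
sink. -/
def collapseFun (f : S → ℝ≥0∞) : M.CollapseState goal → ℝ≥0∞ :=
  redirectFun (M.avoidInf goal)ᶜ 0 f

theorem collapseFun_toCollapse {f : S → ℝ≥0∞} (hf : ∀ s ∈ M.avoidInf goal, f s = 0) (s : S) :
    M.collapseFun goal f (M.toCollapse goal s) = f s :=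
  redirectFun_toRedirect _ (fun s hs => hf s (not_not.1 hs)) s

/-- Since `f` vanishes on the avoid set, merging that set does not change one-step expectations. -/
theorem mean_collapseFun {f : S → ℝ≥0∞} (hf : ∀ s ∈ M.avoidInf goal, f s = 0)
    (s : ((M.avoidInf goal)ᶜ : Set S)) (a : Act) :
    ((M.collapse goal).next (some s) a).mean (M.collapseFun goal f) = (M.next s a).mean f := by
  rw [collapse, mean_next_redirect_some]
  congr 1
  exact funext (collapseFun_toCollapse hf)

theorem reachLimit_avoidInf [Nonempty Act] {s : S} (hs : s ∈ M.avoidInf goal) :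
    M.reachLimit goal s = 0 :=
  nonpos_iff_eq_zero.1 ((reachLimit_le_infPr goal s).trans_eq hs)

theorem reachValue_avoidInf [Nonempty Act] (n : ℕ) {s : S} (hs : s ∈ M.avoidInf goal) :
    M.reachValue goal n s = 0 :=
  nonpos_iff_eq_zero.1 ((M.reachValue_le_reachLimit goal n s).trans_eq (reachLimit_avoidInf hs))

theorem stayValue_avoidInf (α : S → Act) (n : ℕ) {s : S} (hs : s ∈ M.avoidInf goal) :
    M.stayValue α (M.undecided goal) n s = 0 :=
  stayValue_of_notMem _ _ _ _ fun h => h (Or.inr hs)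

variable (M goal) in
theorem goal_notMem_avoidInf [Nonempty Act] : goal ∉ M.avoidInf goal := fun h => by
  simpa [reachLimit_goal] using reachLimit_avoidInf h

variable (M goal) in
theorem toCollapse_goal [Nonempty Act] :
    M.toCollapse goal goal = some ⟨goal, M.goal_notMem_avoidInf goal⟩ :=
  toRedirect_of_mem _ _

theorem coe_ne_goal [Nonempty Act] {s : ((M.avoidInf goal)ᶜ : Set S)}
    (h : some s ≠ M.toCollapse goal goal) : (s : S) ≠ goal := fun hs => h <| by
  rw [toCollapse_goal]
  exact congrArg some (Subtype.ext hs)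

theorem collapseFun_reachValue_zero [Nonempty Act] {x : M.CollapseState goal}
    (hx : x ≠ M.toCollapse goal goal) : M.collapseFun goal (M.reachValue goal 0) x = 0 := by
  cases x with
  | none => rfl
  | some s => exact M.reachValue_zero goal (coe_ne_goal hx)

theorem collapseFun_reachValue_le_one [Nonempty Act] (n : ℕ) (x : M.CollapseState goal) :
    M.collapseFun goal (M.reachValue goal n) x ≤ 1 := by
  cases x with
  | none => exact zero_le_one
  | some s => exact M.reachValue_le_one goal n s

theorem collapseFun_reachValue_succ_le [Nonempty Act] (n : ℕ) {x : M.CollapseState goal}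
    (hx : x ≠ M.toCollapse goal goal) {a : Act} (ha : a ∈ (M.collapse goal).allowed x) :
    M.collapseFun goal (M.reachValue goal (n + 1)) x
      ≤ ((M.collapse goal).next x a).mean (M.collapseFun goal (M.reachValue goal n)) := by
  cases x with
  | none => exact zero_le
  | some s =>
    rw [mean_collapseFun fun s hs => reachValue_avoidInf n hs]
    exact M.reachValue_succ_le goal n (coe_ne_goal hx) ((M.mem_allowed_redirect_some _).1 ha)

variable (M goal) in
/-- An action function of `M`, transferred to the collapsed MDP. -/
def collapseAction [Nonempty Act] (α : S → Act) : M.CollapseState goal → Act :=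
  redirectFun (M.avoidInf goal)ᶜ (Classical.arbitrary Act) α

theorem collapseAction_mem_allowed [Nonempty Act] {α : S → Act} (hα : ∀ s, α s ∈ M.allowed s)
    (x : M.CollapseState goal) : M.collapseAction goal α x ∈ (M.collapse goal).allowed x :=
  redirectFun_mem_allowed _ _ hα _ x

theorem mean_collapseFun_reachLimit_le [Nonempty Act] {α : S → Act}
    (hopt : ∀ s ≠ goal, (M.next s (α s)).mean (M.reachLimit goal) ≤ M.reachLimit goal s)
    {x : M.CollapseState goal} (hx : x ≠ M.toCollapse goal goal) :
    ((M.collapse goal).next x (M.collapseAction goal α x)).mean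
        (M.collapseFun goal (M.reachLimit goal))
      ≤ M.collapseFun goal (M.reachLimit goal) x := by
  cases x with
  | none => exact (mean_next_redirect_none _ _ _ _).le
  | some s =>
    rw [mean_collapseFun fun s hs => reachLimit_avoidInf hs]
    exact hopt s (coe_ne_goal hx)

theorem exists_coe_of_notMem_pair [Nonempty Act] {x : M.CollapseState goal}
    (hx : x ∈ ({M.toCollapse goal goal, none}ᶜ : Set (M.CollapseState goal))) :
    ∃ s, x = some s ∧ (s : S) ∈ M.undecided goal := by
  cases x with
  | none => exact absurd (Or.inr rfl) hx
  | some s =>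
    refine ⟨s, rfl, ?_⟩
    rintro (h | h)
    · exact coe_ne_goal (fun h' => hx (Or.inl h')) h
    · exact s.2 h

theorem collapseFun_stayValue_zero [Nonempty Act] (α : S → Act) {x : M.CollapseState goal}
    (hx : x ∈ ({M.toCollapse goal goal, none}ᶜ : Set (M.CollapseState goal))) :
    M.collapseFun goal (M.stayValue α (M.undecided goal) 0) x = 1 := by
  obtain ⟨s, rfl, hs⟩ := exists_coe_of_notMem_pair hx
  exact M.stayValue_zero α _ hs

theorem collapseFun_stayValue_succ [Nonempty Act] (α : S → Act) (n : ℕ) {x : M.CollapseState goal}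
    (hx : x ∈ ({M.toCollapse goal goal, none}ᶜ : Set (M.CollapseState goal))) :
    ((M.collapse goal).next x (M.collapseAction goal α x)).mean
        (M.collapseFun goal (M.stayValue α (M.undecided goal) n))
      = M.collapseFun goal (M.stayValue α (M.undecided goal) (n + 1)) x := by
  obtain ⟨s, rfl, hs⟩ := exists_coe_of_notMem_pair hx
  rw [mean_collapseFun fun s hs => stayValue_avoidInf α n hs]
  exact (stayValue_succ _ _ _ _ hs).symm

theorem collapseFun_stayValue_le_one (α : S → Act) (n : ℕ) (x : M.CollapseState goal) :
    M.collapseFun goal (M.stayValue α (M.undecided goal) n) x ≤ 1 := by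
  cases x with
  | none => exact zero_le_one
  | some s => exact stayValue_le_one _ _ _ _ _

theorem collapse_reachValue_le_pr [Nonempty Act] (σ : (M.collapse goal).Scheduler) (n : ℕ) (s : S) :
    M.reachValue goal n s
      ≤ σ.pr (M.toCollapse goal s) (evtLE n {M.toCollapse goal goal}) := by
  refine (collapseFun_toCollapse (fun s hs => reachValue_avoidInf n hs) s).symm.trans_le ?_
  exact σ.le_pr_evtLE (f := fun n => M.collapseFun goal (M.reachValue goal n))
    collapseFun_reachValue_le_one (fun x hx => collapseFun_reachValue_zero hx)
    (fun n x hx a ha => collapseFun_reachValue_succ_le n hx ha.allowed) n _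

theorem collapse_reachLimit_le_pr [Nonempty Act] (σ : (M.collapse goal).Scheduler) (s : S) :
    M.reachLimit goal s ≤ σ.pr (M.toCollapse goal s) (evt {M.toCollapse goal goal}) := by
  rw [← σ.iSup_pr_evtLE]
  exact iSup_mono fun n => collapse_reachValue_le_pr σ n s

theorem collapse_pr_evtLE_le [Nonempty Act] {α : S → Act} (hα : ∀ s, α s ∈ M.allowed s)
    (hopt : ∀ s ≠ goal, (M.next s (α s)).mean (M.reachLimit goal) ≤ M.reachLimit goal s)
    (n : ℕ) (s : S) :
    ((M.collapse goal).ofAction _ (collapseAction_mem_allowed hα)).pr (M.toCollapse goal s)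
      (evtLE n {M.toCollapse goal goal}) ≤ M.reachLimit goal s := by
  refine le_of_le_of_eq ?_ (collapseFun_toCollapse (fun s hs => reachLimit_avoidInf hs) s)
  refine Scheduler.pr_evtLE_le _ ?_ (fun x hx a ha => ?_) n _
  · rintro x rfl
    rw [collapseFun_toCollapse fun s hs => reachLimit_avoidInf hs, reachLimit_goal]
  · rw [eq_of_plays_ofAction ha]
    exact mean_collapseFun_reachLimit_le hopt hx

theorem collapse_pr_glbLE_le [Nonempty Act] {α : S → Act} (hα : ∀ s, α s ∈ M.allowed s)
    (n : ℕ) (s : S) :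
    ((M.collapse goal).ofAction _ (collapseAction_mem_allowed hα)).pr (M.toCollapse goal s)
      (glbLE n ({M.toCollapse goal goal, none}ᶜ)) ≤ M.stayValue α (M.undecided goal) n s := by
  refine le_of_le_of_eq ?_ (collapseFun_toCollapse (fun s hs => stayValue_avoidInf α n hs) s)
  refine Scheduler.pr_glbLE_le _
    (g := fun n => M.collapseFun goal (M.stayValue α (M.undecided goal) n))
    (fun x hx => (collapseFun_stayValue_zero α hx).ge) (fun n x hx a ha => ?_) n _
  rw [eq_of_plays_ofAction ha, ← collapseFun_stayValue_succ α n hx]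
  exact PMF.mean_mono _ fun y => Set.indicator_le_self' (fun _ _ => zero_le) y

theorem infPr_unfoldLo_le [Nonempty Act] (hfin : M.FinitelyActionBranching) (n : ℕ) (s : S) :
    (M.collapse goal).infPr (M.toCollapse goal s) (evtLE n {M.toCollapse goal goal})
      ≤ M.reachLimit goal s := by
  obtain ⟨α, hα, hopt⟩ := exists_optimal_action goal hfin
  exact (iInf_le _ _).trans (collapse_pr_evtLE_le hα hopt n s)

/-- A path that visits `goal` does so without visiting the sink before, so within `n` steps it has
visited `goal` or has stayed away from both. -/
theorem le_infPr_unfoldHi [Nonempty Act] (n : ℕ) (s : S) :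
    M.reachLimit goal s ≤ (M.collapse goal).infPr (M.toCollapse goal s)
      (evtLE n {M.toCollapse goal goal} ∪ glbLE n ({M.toCollapse goal goal, none}ᶜ)) := by
  refine le_iInf fun σ => (collapse_reachLimit_le_pr σ s).trans ?_
  have hsink := σ.pr_leave_sink (M.toCollapse goal s) (b := none)
    (fun a => next_redirect_none _ _ a)
  rw [← add_zero (σ.pr _ (_ ∪ _)), ← hsink]
  refine (σ.pr_mono _ ?_).trans (σ.pr_union_le _ _ _)
  rintro ω ⟨m, hm⟩
  have hm' : ω m ≠ none := by rw [show ω m = _ from hm, toCollapse_goal]; simp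
  by_contra hcon
  have hglb : ¬ ∀ k ≤ n, ω k ∈ ({M.toCollapse goal goal, none}ᶜ : Set (M.CollapseState goal)) :=
    fun h => hcon (Or.inl (Or.inr h))
  push Not at hglb
  obtain ⟨k, hk, hωk⟩ := hglb
  rcases not_not.1 hωk with h | h
  · exact hcon (Or.inl (Or.inl ⟨k, hk, h⟩))
  · rcases le_total k m with hkm | hmk
    · exact hcon (Or.inr ⟨k, m, hkm, h, hm'⟩)
    · exact hcon (Or.inl (Or.inl ⟨m, hmk.trans hk, hm⟩))

theorem infPr_unfoldHi_le [Nonempty Act] {α : S → Act} (hα : ∀ s, α s ∈ M.allowed s)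
    (hopt : ∀ s ≠ goal, (M.next s (α s)).mean (M.reachLimit goal) ≤ M.reachLimit goal s)
    (n : ℕ) (s : S) :
    (M.collapse goal).infPr (M.toCollapse goal s)
      (evtLE n {M.toCollapse goal goal} ∪ glbLE n ({M.toCollapse goal goal, none}ᶜ))
      ≤ M.reachLimit goal s + M.stayValue α (M.undecided goal) n s :=
  (iInf_le _ _).trans ((Scheduler.pr_union_le _ _ _ _).trans
    (add_le_add (collapse_pr_evtLE_le hα hopt n s) (collapse_pr_glbLE_le hα n s)))

end collapse

/-! ### The sliced MDPs -/

section slice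

theorem sliceStates_mono : Monotone (M.sliceStates s₀ goal) :=
  monotone_nat_of_le_succ fun _ => Set.subset_union_left

variable (M s₀ goal) in
theorem toCollapse_init_mem (n : ℕ) : M.toCollapse goal s₀ ∈ M.sliceStates s₀ goal n :=
  sliceStates_mono n.zero_le (Or.inl rfl)

variable (M s₀ goal) in
theorem toCollapse_goal_mem (n : ℕ) : M.toCollapse goal goal ∈ M.sliceStates s₀ goal n :=
  sliceStates_mono n.zero_le (Or.inr (Or.inl rfl))

variable (M s₀ goal) in
theorem none_mem_sliceStates (n : ℕ) : none ∈ M.sliceStates s₀ goal n :=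
  sliceStates_mono n.zero_le (Or.inr (Or.inr rfl))

/-- Every possible successor of a state of the `m`-th slice belongs to the next slice. -/
theorem mem_sliceStates_succ {m : ℕ} {x y : M.CollapseState goal} {a : Act}
    (hx : x ∈ M.sliceStates s₀ goal m) (hy : y ∈ ((M.collapse goal).next x a).support) :
    y ∈ M.sliceStates s₀ goal (m + 1) := by
  by_cases ha : a ∈ (M.collapse goal).En x
  · rw [PMF.mem_support_iff, next_apply_of_mem _ ha] at hy
    exact Or.inr ⟨x, hx, a, pos_iff_ne_zero.2 hy⟩
  · rw [next_of_notMem _ ha, PMF.support_pure] at hy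
    rw [show y = x from hy]
    exact Or.inl hx

theorem toSlice_goal (n : ℕ) :
    M.toSlice s₀ goal n goal = some ⟨M.toCollapse goal goal, M.toCollapse_goal_mem s₀ goal n⟩ :=
  toRedirect_of_mem _ _

theorem toSlice_init (n : ℕ) :
    M.toSlice s₀ goal n s₀ = some ⟨M.toCollapse goal s₀, M.toCollapse_init_mem s₀ goal n⟩ :=
  toRedirect_of_mem _ _

theorem coe_ne_toCollapse_goal {n : ℕ} {x : M.sliceStates s₀ goal n}
    (h : some x ≠ M.toSlice s₀ goal n goal) : (x : M.CollapseState goal) ≠ M.toCollapse goal goal :=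
  fun hx => h <| by
    rw [toSlice_goal]
    exact congrArg some (Subtype.ext hx)

variable (M s₀ goal) in
/-- The state of the `n`-th slice that represents the sink of the collapsed MDP. -/
def sliceBot (n : ℕ) : M.SliceState s₀ goal n := some ⟨none, M.none_mem_sliceStates s₀ goal n⟩

theorem next_sliceBot (n : ℕ) (a : Act) :
    (M.slice s₀ goal n).next (M.sliceBot s₀ goal n) a = PMF.pure (M.sliceBot s₀ goal n) := by
  rw [slice, sliceBot, next_redirect_some, collapse, next_redirect_none, PMF.pure_map,
    toRedirect_of_mem]

open Classical in
variable (M s₀ goal) in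
/-- The function on the `n`-th slice that agrees with `f` on the states from which the slice
cannot be left within `k` steps, and equals `c` at all other states. -/
def innerFun (n k : ℕ) (c : ℝ≥0∞) (f : M.CollapseState goal → ℝ≥0∞) :
    M.SliceState s₀ goal n → ℝ≥0∞ :=
  redirectFun _ c fun x => if ∃ m, m + k ≤ n ∧ x ∈ M.sliceStates s₀ goal m then f x else c

theorem innerFun_some_of_mem {n k m : ℕ} {c : ℝ≥0∞} {f : M.CollapseState goal → ℝ≥0∞}
    {x : M.sliceStates s₀ goal n} (hm : m + k ≤ n)
    (hx : (x : M.CollapseState goal) ∈ M.sliceStates s₀ goal m) :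
    M.innerFun s₀ goal n k c f (some x) = f x :=
  if_pos ⟨m, hm, hx⟩

theorem mean_innerFun {n k m : ℕ} {c : ℝ≥0∞} {f : M.CollapseState goal → ℝ≥0∞}
    {x : M.sliceStates s₀ goal n} (hm : m + (k + 1) ≤ n)
    (hx : (x : M.CollapseState goal) ∈ M.sliceStates s₀ goal m) (a : Act) :
    ((M.slice s₀ goal n).next (some x) a).mean (M.innerFun s₀ goal n k c f)
      = ((M.collapse goal).next x a).mean f := by
  rw [slice, mean_next_redirect_some]
  refine tsum_congr fun y => ?_
  by_cases hy : y ∈ ((M.collapse goal).next x a).support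
  · have hy' := mem_sliceStates_succ hx hy
    have hyn : y ∈ M.sliceStates s₀ goal n := sliceStates_mono (by omega) hy'
    dsimp only
    rw [toRedirect_of_mem _ hyn, innerFun_some_of_mem (by omega) hy']
  · rw [PMF.mem_support_iff, not_not] at hy
    rw [hy, zero_mul, zero_mul]

theorem innerFun_eq_or {n k : ℕ} (c : ℝ≥0∞) (f : M.CollapseState goal → ℝ≥0∞)
    (x : M.SliceState s₀ goal n) : M.innerFun s₀ goal n k c f x = c ∨
      ∃ y, x = some y ∧ ∃ m, m + k ≤ n ∧ (y : M.CollapseState goal) ∈ M.sliceStates s₀ goal m := by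
  cases x with
  | none => exact Or.inl rfl
  | some y =>
    by_cases h : ∃ m, m + k ≤ n ∧ (y : M.CollapseState goal) ∈ M.sliceStates s₀ goal m
    · exact Or.inr ⟨y, rfl, h⟩
    · exact Or.inl (if_neg h)

theorem innerFun_le_one {n k : ℕ} {c : ℝ≥0∞} {f : M.CollapseState goal → ℝ≥0∞} (hc : c ≤ 1)
    (hf : ∀ x, f x ≤ 1) (x : M.SliceState s₀ goal n) : M.innerFun s₀ goal n k c f x ≤ 1 := by
  rcases innerFun_eq_or (k := k) c f x with h | ⟨y, rfl, m, hm, hy⟩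
  · rwa [h]
  · rw [innerFun_some_of_mem hm hy]
    exact hf _

theorem innerFun_init {n : ℕ} {c : ℝ≥0∞} {f : M.CollapseState goal → ℝ≥0∞} :
    M.innerFun s₀ goal n n c f (M.toSlice s₀ goal n s₀) = f (M.toCollapse goal s₀) := by
  rw [toSlice_init, innerFun_some_of_mem (m := 0) (by omega) (M.toCollapse_init_mem s₀ goal 0)]

variable [Nonempty Act]

/-- Within `n` steps the `n`-th slice and the collapsed MDP behave alike; the test functions are cut
down to `0` at the states from which the slice could be left in the remaining time. -/
theorem reachValue_le_infPr_sliceLo (n : ℕ) :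
    M.reachValue goal n s₀ ≤ (M.slice s₀ goal n).infPr (M.toSlice s₀ goal n s₀)
      (evt {M.toSlice s₀ goal n goal}) := by
  refine le_iInf fun σ => ?_
  rw [← σ.iSup_pr_evtLE]
  refine le_iSup_of_le n ?_
  refine (collapseFun_toCollapse (fun s hs => reachValue_avoidInf n hs) s₀).symm.trans_le ?_
  rw [← innerFun_init (n := n) (c := 0) (f := M.collapseFun goal (M.reachValue goal n))]
  refine σ.le_pr_evtLE
    (f := fun k => M.innerFun s₀ goal n k 0 (M.collapseFun goal (M.reachValue goal k)))
    (fun k => innerFun_le_one zero_le_one (collapseFun_reachValue_le_one k))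
    (fun x hx => ?_) (fun k x hx a ha => ?_) n _
  · rcases innerFun_eq_or (k := 0) 0 (M.collapseFun goal (M.reachValue goal 0)) x with
      h | ⟨y, rfl, m, hm, hy⟩
    · exact h
    · rw [innerFun_some_of_mem hm hy]
      exact collapseFun_reachValue_zero (coe_ne_toCollapse_goal hx)
  · rcases innerFun_eq_or (k := k + 1) 0 (M.collapseFun goal (M.reachValue goal (k + 1))) x with
      h | ⟨y, rfl, m, hm, hy⟩
    · exact h.trans_le zero_le
    · rw [innerFun_some_of_mem hm hy, mean_innerFun hm hy]
      exact collapseFun_reachValue_succ_le k (coe_ne_toCollapse_goal hx)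
        ((mem_allowed_redirect_some _ _).1 ha.allowed)

/-- The sink of the slice is a target here, so giving it the maximal value `1` keeps the functions
subharmonic. -/
theorem reachLimit_le_infPr_sliceHi (n : ℕ) :
    M.reachLimit goal s₀ ≤ (M.slice s₀ goal n).infPr (M.toSlice s₀ goal n s₀)
      (evt {M.toSlice s₀ goal n goal, none}) := by
  refine le_iInf fun σ => ?_
  rw [← σ.iSup_pr_evtLE]
  refine iSup_mono fun k => ?_
  refine (collapseFun_toCollapse (fun s hs => reachValue_avoidInf k hs) s₀).symm.trans_le ?_
  rw [← redirectFun_toRedirect_of_mem (M.sliceStates s₀ goal n) 1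
    (M.collapseFun goal (M.reachValue goal k))
    (M.toCollapse_init_mem s₀ goal n)]
  refine σ.le_pr_evtLE
    (f := fun k => redirectFun _ 1 (M.collapseFun goal (M.reachValue goal k)))
    (fun k x => ?_) (fun x hx => ?_) (fun k x hx a ha => ?_) k _
  · cases x with
    | none => exact le_rfl
    | some x => exact collapseFun_reachValue_le_one k _
  · cases x with
    | none => exact absurd (Or.inr rfl) hx
    | some x =>
      exact collapseFun_reachValue_zero (coe_ne_toCollapse_goal fun h => hx (Or.inl h))
  · cases x with
    | none => exact absurd (Or.inr rfl) hx
    | some x =>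
      refine (collapseFun_reachValue_succ_le k (coe_ne_toCollapse_goal fun h => hx (Or.inl h))
        ((mem_allowed_redirect_some _ _).1 ha.allowed)).trans ?_
      rw [slice, mean_next_redirect_some]
      refine PMF.mean_mono _ fun y => ?_
      by_cases hy : y ∈ M.sliceStates s₀ goal n
      · rw [redirectFun_toRedirect_of_mem _ _ _ hy]
      · rw [toRedirect_of_notMem _ hy]
        exact collapseFun_reachValue_le_one k _

variable (M s₀ goal) in
/-- An action function of `M`, transferred to the `n`-th slice. -/
def sliceAction (n : ℕ) (α : S → Act) : M.SliceState s₀ goal n → Act :=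
  redirectFun _ (Classical.arbitrary Act) (M.collapseAction goal α)

theorem sliceAction_mem_allowed {α : S → Act} (hα : ∀ s, α s ∈ M.allowed s) (n : ℕ)
    (x : M.SliceState s₀ goal n) : M.sliceAction s₀ goal n α x ∈ (M.slice s₀ goal n).allowed x :=
  redirectFun_mem_allowed _ _ (collapseAction_mem_allowed hα) _ x

/-- The sink of the slice never reaches `goal`, so the limit of value iteration stays superharmonic
when it is given the value `0` there. -/
theorem slice_pr_evt_le {α : S → Act} (hα : ∀ s, α s ∈ M.allowed s)
    (hopt : ∀ s ≠ goal, (M.next s (α s)).mean (M.reachLimit goal) ≤ M.reachLimit goal s) (n : ℕ) :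
    ((M.slice s₀ goal n).ofAction _ (sliceAction_mem_allowed hα n)).pr (M.toSlice s₀ goal n s₀)
      (evt {M.toSlice s₀ goal n goal}) ≤ M.reachLimit goal s₀ := by
  have hz := fun s (hs : s ∈ M.avoidInf goal) => reachLimit_avoidInf hs
  rw [← Scheduler.iSup_pr_evtLE]
  refine iSup_le fun k => ?_
  refine le_of_le_of_eq ?_ (collapseFun_toCollapse hz s₀)
  rw [← redirectFun_toRedirect_of_mem (M.sliceStates s₀ goal n) 0
    (M.collapseFun goal (M.reachLimit goal))
    (M.toCollapse_init_mem s₀ goal n)]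
  refine Scheduler.pr_evtLE_le _ ?_ (fun x hx a ha => ?_) k _
  · rintro x rfl
    rw [toSlice, redirectFun_toRedirect_of_mem _ _ _ (M.toCollapse_goal_mem s₀ goal n),
      collapseFun_toCollapse hz, reachLimit_goal]
  · rw [eq_of_plays_ofAction ha]
    cases x with
    | none => exact (mean_next_redirect_none _ _ _ _).le
    | some x =>
      refine le_trans ?_ (mean_collapseFun_reachLimit_le hopt (coe_ne_toCollapse_goal hx))
      rw [slice, mean_next_redirect_some]
      refine PMF.mean_mono _ fun y => ?_
      by_cases hy : y ∈ M.sliceStates s₀ goal n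
      · rw [redirectFun_toRedirect_of_mem _ _ _ hy]
      · rw [toRedirect_of_notMem _ hy]
        exact zero_le

/-- For an upper bound, the states from which the slice could be left in the remaining time get the
trivial value `1`. -/
theorem slice_pr_glbLE_le {α : S → Act} (hα : ∀ s, α s ∈ M.allowed s) (n : ℕ) :
    ((M.slice s₀ goal n).ofAction _ (sliceAction_mem_allowed hα n)).pr (M.toSlice s₀ goal n s₀)
      (glbLE n ({M.toSlice s₀ goal n goal, M.sliceBot s₀ goal n}ᶜ))
        ≤ M.stayValue α (M.undecided goal) n s₀ := by
  refine le_of_le_of_eq ?_ (collapseFun_toCollapse (fun s hs => stayValue_avoidInf α n hs) s₀)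
  rw [← innerFun_init (n := n) (c := 1)
    (f := M.collapseFun goal (M.stayValue α (M.undecided goal) n))]
  have hx' : ∀ x : M.sliceStates s₀ goal n,
      some x ∈ ({M.toSlice s₀ goal n goal, M.sliceBot s₀ goal n}ᶜ : Set (M.SliceState s₀ goal n)) →
      (x : M.CollapseState goal) ∈
        ({M.toCollapse goal goal, none}ᶜ : Set (M.CollapseState goal)) := by
    rintro x hx (h | h)
    · exact coe_ne_toCollapse_goal (fun h' => hx (Or.inl h')) h
    · exact hx (Or.inr (congrArg some (Subtype.ext h)))
  refine Scheduler.pr_glbLE_le _ (g := fun k => M.innerFun s₀ goal n k 1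
    (M.collapseFun goal (M.stayValue α (M.undecided goal) k)))
    (fun x hx => ?_) (fun k x hx a ha => ?_) n _
  · rcases innerFun_eq_or (k := 0) 1
      (M.collapseFun goal (M.stayValue α (M.undecided goal) 0)) x with h | ⟨y, rfl, m, hm, hy⟩
    · exact h.ge
    · rw [innerFun_some_of_mem hm hy, collapseFun_stayValue_zero α (hx' y hx)]
  · refine (PMF.mean_mono _ fun y => Set.indicator_le_self' (fun _ _ => zero_le) y).trans ?_
    rcases innerFun_eq_or (k := k + 1) 1
      (M.collapseFun goal (M.stayValue α (M.undecided goal) (k + 1))) x with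
      h | ⟨y, rfl, m, hm, hy⟩
    · rw [h]
      exact PMF.mean_le _ fun y _ => innerFun_le_one le_rfl (collapseFun_stayValue_le_one α k) y
    · rw [eq_of_plays_ofAction ha, innerFun_some_of_mem hm hy, mean_innerFun hm hy,
        ← collapseFun_stayValue_succ α k (hx' y hx)]
      rfl

theorem infPr_sliceLo_le (hfin : M.FinitelyActionBranching) (n : ℕ) :
    (M.slice s₀ goal n).infPr (M.toSlice s₀ goal n s₀) (evt {M.toSlice s₀ goal n goal})
      ≤ M.reachLimit goal s₀ := by
  obtain ⟨α, hα, hopt⟩ := exists_optimal_action goal hfin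
  exact (iInf_le _ _).trans (slice_pr_evt_le hα hopt n)

/-- Both sinks are absorbing, so a path that visits the sink of the slice but not `goal` does not
visit the sink of the collapsed MDP. -/
theorem infPr_sliceHi_le {α : S → Act} (hα : ∀ s, α s ∈ M.allowed s)
    (hopt : ∀ s ≠ goal, (M.next s (α s)).mean (M.reachLimit goal) ≤ M.reachLimit goal s) (n : ℕ) :
    (M.slice s₀ goal n).infPr (M.toSlice s₀ goal n s₀) (evt {M.toSlice s₀ goal n goal, none})
      ≤ M.reachLimit goal s₀ + M.stayValue α (M.undecided goal) n s₀ := by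
  refine (iInf_le _ ((M.slice s₀ goal n).ofAction _ (sliceAction_mem_allowed hα n))).trans ?_
  refine le_trans ?_ (add_le_add (slice_pr_evt_le hα hopt n) (slice_pr_glbLE_le hα n))
  set σ := (M.slice s₀ goal n).ofAction _ (sliceAction_mem_allowed hα n)
  have h1 := σ.pr_leave_sink (M.toSlice s₀ goal n s₀) (b := none)
    (fun a => next_redirect_none _ _ a)
  have h2 := σ.pr_leave_sink (M.toSlice s₀ goal n s₀) (b := M.sliceBot s₀ goal n)
    (next_sliceBot n)
  rw [← add_zero (_ + _), ← (measure_union_null h1 h2 : σ.pr _ (_ ∪ _) = 0)]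
  refine le_trans (σ.pr_mono _ ?_) ((σ.pr_union_le _ _ _).trans
    (add_le_add_left (σ.pr_union_le _ _ _) _))
  -- The two null events are those of leaving one of the sinks.
  rintro ω ⟨m, hm | hm⟩
  · exact Or.inl (Or.inl ⟨m, hm⟩)
  · by_contra hcon
    have hglb : ¬ ∀ k ≤ n, ω k ∈
        ({M.toSlice s₀ goal n goal, M.sliceBot s₀ goal n}ᶜ : Set (M.SliceState s₀ goal n)) :=
      fun h => hcon (Or.inl (Or.inr h))
    push Not at hglb
    obtain ⟨k, hk, hωk⟩ := hglb
    rcases not_not.1 hωk with h | h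
    · exact hcon (Or.inl (Or.inl ⟨k, h⟩))
    · have h : ω k = M.sliceBot s₀ goal n := h
      rcases le_total k m with hkm | hmk
      · refine hcon (Or.inr (Or.inr ⟨k, m, hkm, h, ?_⟩))
        rw [hm]
        exact Option.some_ne_none _ |>.symm
      · refine hcon (Or.inr (Or.inl ⟨m, k, hmk, hm, ?_⟩))
        rw [h]
        exact Option.some_ne_none _

end slice

end MDP

/-! ### Termination and correctness of the loops -/

theorem repeatReturns_spec {lo hi : ℕ → ℝ} {ε v : ℝ} (hlo : ∀ n, lo n ≤ v) (hhi : ∀ n, v ≤ hi n)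
    {n : ℕ} {u : ℝ} (h : RepeatReturns lo hi ε n u) : |u - v| ≤ ε := by
  induction h with
  | exit n h =>
    rw [abs_le] at h ⊢
    constructor <;> linarith [hlo (n + 1), hhi (n + 1)]
  | next _ _ _ _ ih => exact ih

theorem exists_repeatReturns {lo hi : ℕ → ℝ} {ε : ℝ} {m : ℕ} (h : |hi m - lo m| ≤ ε) {n : ℕ}
    (hn : n < m) : ∃ u, RepeatReturns lo hi ε n u := by
  by_cases hs : |hi (n + 1) - lo (n + 1)| ≤ ε
  · exact ⟨_, .exit n hs⟩
  · have hne : n + 1 ≠ m := by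
      rintro rfl
      exact hs h
    obtain ⟨u, hu⟩ := exists_repeatReturns h (n := n + 1) (by omega)
    exact ⟨u, .next n u hs hu⟩
termination_by m - n

/-- If the two sequences enclose `v` and are squeezed towards it by `L` and `v + G`, then the loop
terminates with an `ε`-approximation of `v`. -/
theorem repeatReturns_of_squeeze {lo hi L G : ℕ → ℝ≥0∞} {v : ℝ≥0∞} (hv : v ≠ ∞)
    (hlo : ∀ n, lo n ≤ v) (hhi : ∀ n, v ≤ hi n) (hL : ∀ n, L n ≤ lo n) (hG : ∀ n, hi n ≤ v + G n)
    (hGtop : ∀ n, G n ≠ ∞)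
    (hLlim : Filter.Tendsto L Filter.atTop (nhds v))
    (hGlim : Filter.Tendsto G Filter.atTop (nhds 0)) {ε : ℝ} (hε : 0 < ε) :
    (∃ u, RepeatReturns (fun n => (lo n).toReal) (fun n => (hi n).toReal) ε 0 u) ∧
      ∀ u, RepeatReturns (fun n => (lo n).toReal) (fun n => (hi n).toReal) ε 0 u →
        |u - v.toReal| ≤ ε := by
  have hhitop : ∀ n, hi n ≠ ∞ := fun n =>
    ne_top_of_le_ne_top (ENNReal.add_ne_top.2 ⟨hv, hGtop n⟩) (hG n)
  have hlotop : ∀ n, lo n ≠ ∞ := fun n => ne_top_of_le_ne_top hv (hlo n)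
  have hlo' : ∀ n, (lo n).toReal ≤ v.toReal := fun n => ENNReal.toReal_mono hv (hlo n)
  have hhi' : ∀ n, v.toReal ≤ (hi n).toReal := fun n => ENNReal.toReal_mono (hhitop n) (hhi n)
  refine ⟨?_, fun u hu => repeatReturns_spec hlo' hhi' hu⟩
  have h1 := (ENNReal.tendsto_toReal hv).comp hLlim
  have h2 := (ENNReal.tendsto_toReal ENNReal.zero_ne_top).comp hGlim
  have h3 := (h2.sub h1).add_const v.toReal
  simp only [ENNReal.toReal_zero, zero_sub, neg_add_cancel, Function.comp_apply] at h3
  obtain ⟨m, hm, hm0⟩ := ((h3.eventually_lt_const hε).and (Filter.eventually_gt_atTop 0)).exists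
  refine exists_repeatReturns (m := m) ?_ hm0
  have h4 : (L m).toReal ≤ (lo m).toReal := ENNReal.toReal_mono (hlotop m) (hL m)
  have h5 : (hi m).toReal ≤ v.toReal + (G m).toReal := by
    rw [← ENNReal.toReal_add hv (hGtop m)]
    exact ENNReal.toReal_mono (ENNReal.add_ne_top.2 ⟨hv, hGtop m⟩) (hG m)
  rw [abs_of_nonneg (by linarith [hlo' m, hhi' m])]
  linarith

end

theorem theorem4 {S Act : Type*} [Countable S] [Countable Act] [Nonempty Act]
    (M : MDP S Act) (s₀ goal : S)
    (hfin : M.FinitelyActionBranching) (hdec : M.InfDecisive goal s₀)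
    (ε : ℝ) (hε : 0 < ε) :
    ((∃ v, ApproxScheme1InfReturns M s₀ goal ε v) ∧
      ∀ v, ApproxScheme1InfReturns M s₀ goal ε v →
        |v - (M.infPr s₀ (evt {goal})).toReal| ≤ ε) ∧
    ((∃ v, ApproxScheme2InfReturns M s₀ goal ε v) ∧
      ∀ v, ApproxScheme2InfReturns M s₀ goal ε v →
        |v - (M.infPr s₀ (evt {goal})).toReal| ≤ ε) := by
  obtain ⟨α, hα, hopt⟩ := MDP.exists_optimal_action goal hfin
  rw [MDP.infPr_evt goal hfin]
  have hv : M.reachLimit goal s₀ ≠ ∞ :=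
    ne_top_of_le_ne_top ENNReal.one_ne_top (M.reachLimit_le_one goal s₀)
  have hGtop : ∀ n, M.stayValue α (M.undecided goal) n s₀ ≠ ∞ := fun n =>
    ne_top_of_le_ne_top ENNReal.one_ne_top (M.stayValue_le_one _ _ n s₀)
  have hLlim : Filter.Tendsto (fun n => M.reachValue goal n s₀) Filter.atTop
      (nhds (M.reachLimit goal s₀)) :=
    tendsto_atTop_iSup fun m n hmn => M.monotone_reachValue goal hmn s₀
  have hGlim : Filter.Tendsto (fun n => M.stayValue α (M.undecided goal) n s₀) Filter.atTop
      (nhds 0) := by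
    have h1 := hdec _ (M.isPure_ofAction α hα) (M.isPositional_ofAction α hα)
    have h2 : (M.ofAction α hα).pr s₀ (evt ({goal} ∪ M.avoidInf goal)) = 1 := by
      rw [← h1]
      congr 1
      ext ω
      simp [evt, exists_or]
    -- `undecided` is the complement of the set that decisiveness says is visited.
    exact tendsto_of_tendsto_of_tendsto_of_le_of_le tendsto_const_nhds
      ((M.ofAction α hα).tendsto_pr_glbLE_compl h2) (fun _ => zero_le)
      (fun n => M.stayValue_le_pr α _ hα n s₀)
  exact ⟨repeatReturns_of_squeeze hv (fun n => MDP.infPr_unfoldLo_le hfin n s₀)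
      (fun n => MDP.le_infPr_unfoldHi n s₀)
      (fun n => le_iInf fun σ => MDP.collapse_reachValue_le_pr σ n s₀)
      (fun n => MDP.infPr_unfoldHi_le hα hopt n s₀) hGtop hLlim hGlim hε,
    repeatReturns_of_squeeze hv (MDP.infPr_sliceLo_le hfin) MDP.reachLimit_le_infPr_sliceHi
      MDP.reachValue_le_infPr_sliceLo (MDP.infPr_sliceHi_le hα hopt) hGtop hLlim hGlim hε⟩
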